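/- Let $\mathcal H_A,\mathcal H_B$ be finite-dimensional Hilbert spaces of dimensions $d_A,d_B\ge 1$ with fixed computational bases, and let $U$ be a bipartite permutation unitary on $\mathcal H_A\otimes\mathcal H_B$, i.e. a unitary $d_Ad_B\times d_Ad_B$ matrix all of whose entries are $0$ or $1$. Let $r$ be the Schmidt rank of $U$: $U=\sum_{j=1}^r X_j\otimes Y_j$ with linearly independent operators $X_1,\dots,X_r$ on $\mathcal H_A$ and linearly independent operators $Y_1,\dots,Y_r$ on $\mathcal H_B$. Let $B_j$ denote the $j$-th Bell number, the number of partitions of a set of $j$ elements, and put $$E_1=\log_2(B_{r+1})+r+\log_2 r,\qquad E_2=8r-8 .$$ Then $U$ can be implemented exactly, deterministically and on a single copy by local operations and classical communication (finitely many rounds, finite-dimensional local ancillas in fixed initial states) with the help of $\min\{E_1,E_2\}$ ebits of initial entanglement and twice as many bits of classical communication. More precisely, for each $E\in\{E_1,E_2\}$ (hence also for $E=\min\{E_1,E_2\}$) there is such a protocol that starts from a shared maximally entangled state of Schmidt rank $2^{E}$ (which is a positive integer) and sends $2E$ classical bits in total. Here a maximally entangled state of Schmidt rank $N$ counts as $\log_2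 N$ ebits, and a classical message from an alphabet of $N$ signals, sent in either direction, counts as $\log_2 N$ bits. -/

import Mathlib

open scoped Kronecker Matrix

noncomputable section

namespace BipartiteLOCC

/-! ## Bipartite permutation unitaries and the Schmidt rank -/

/-- A permutation unitary: a unitary matrix all of whose entries are `0` or `1`. -/
def IsPermutationUnitary {ι : Type} [Fintype ι] [DecidableEq ι] (U : Matrix ι ι ℂ) : Prop :=
  U ∈ Matrix.unitaryGroup ι ℂ ∧ ∀ i j, U i j = 0 ∨ U i j = 1

/-- `U` has Schmidt rank `r`: there is an expansion `U = ∑ j, X j ⊗ Y j` with `r` terms in which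
the operators `X j` on the first system are linearly independent, and so are the operators `Y j`
on the second system. -/
def HasSchmidtRank {A B : Type} (U : Matrix (A × B) (A × B) ℂ) (r : ℕ) : Prop :=
  ∃ (X : Fin r → Matrix A A ℂ) (Y : Fin r → Matrix B B ℂ),
    LinearIndependent ℂ X ∧ LinearIndependent ℂ Y ∧ U = ∑ j, X j ⊗ₖ Y j

/-! ## Local operations and classical communication -/

/-- Finite protocols of local operations and classical communication (LOCC) between Alice, whose
laboratory is a quantum system with computational basis `α`, and Bob, whose laboratory has
computational basis `β`.

In a step `alice K hK next`, Alice applies to her laboratory the quantum instrument with Kraus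
operators `K x s`; the classical outcome `x : M` is sent to Bob as a message from the alphabet
`M`, the outcome `s : κ` is forgotten, and the protocol goes on with `next x`, which may depend
on the message. A step `bob K hK next` is the same with the two parties exchanged. The condition
`hK` says that the instrument is trace preserving. An operation without any communication is a
step with a one-element alphabet. -/
inductive LOCC (α β : Type) [Fintype α] [DecidableEq α] [Fintype β] [DecidableEq β] : Type 1
  | done : LOCC α β
  | alice {M κ : Type} [Fintype M] [Fintype κ] (K : M → κ → Matrix α α ℂ)
      (hK : ∑ x, ∑ s, (K x s)ᴴ * K x s = 1) (next : M → LOCC α β) : LOCC α β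
  | bob {M κ : Type} [Fintype M] [Fintype κ] (K : M → κ → Matrix β β ℂ)
      (hK : ∑ x, ∑ s, (K x s)ᴴ * K x s = 1) (next : M → LOCC α β) : LOCC α β

namespace LOCC

variable {α β : Type} [Fintype α] [DecidableEq α] [Fintype β] [DecidableEq β]

/-- The action of a protocol on operators of the joint laboratory (the state is averaged over all
classical messages, so that the protocol is a quantum channel). -/
def run : LOCC α β → Matrix (α × β) (α × β) ℂ → Matrix (α × β) (α × β) ℂ
  | done, σ => σ
  | alice K _ next, σ =>
      ∑ x, (next x).run
        (∑ s, (K x s ⊗ₖ (1 : Matrix β β ℂ)) * σ * (K x s ⊗ₖ (1 : Matrix β β ℂ))ᴴ)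
  | bob K _ next, σ =>
      ∑ x, (next x).run
        (∑ s, ((1 : Matrix α α ℂ) ⊗ₖ K x s) * σ * ((1 : Matrix α α ℂ) ⊗ₖ K x s)ᴴ)

/-- The number of bits of classical communication, in both directions together: a message from
an alphabet of size `m` counts as `log₂ m` bits, and the worst case over all runs is taken. -/
def cbits : LOCC α β → ℝ
  | done => 0
  | alice (M := M) _ _ next => Real.logb 2 (Fintype.card M) + ⨆ x, (next x).cbits
  | bob (M := M) _ _ next => Real.logb 2 (Fintype.card M) + ⨆ x, (next x).cbits

end LOCC

/-! ## Implementing a bipartite operator with shared entanglement -/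

/-- The maximally entangled state `N^(-1/2) ∑ k, |k⟩|k⟩` of Schmidt rank `N`. -/
def maxEntangled (N : ℕ) : Fin N × Fin N → ℂ :=
  fun p => if p.1 = p.2 then ((1 / Real.sqrt N : ℝ) : ℂ) else 0

/-- A one-shot LOCC protocol with shared entanglement, for operators on the bipartite system with
computational basis `A × B`. Alice and Bob share a maximally entangled state of Schmidt rank
`N`; Alice has a further local ancilla with basis `S` in the initial state `|s₀⟩`, and Bob one
with basis `T` in the initial state `|t₀⟩`. -/
structure AssistedProtocol (A B : Type) [Fintype A] [DecidableEq A] [Fintype B]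
    [DecidableEq B] where
  N : ℕ
  N_pos : 0 < N
  S : Type
  T : Type
  [fintypeS : Fintype S]
  [decEqS : DecidableEq S]
  [fintypeT : Fintype T]
  [decEqT : DecidableEq T]
  s₀ : S
  t₀ : T
  locc : LOCC (A × Fin N × S) (B × Fin N × T)

namespace AssistedProtocol

attribute [instance] fintypeS decEqS fintypeT decEqT

variable {A B : Type} [Fintype A] [DecidableEq A] [Fintype B] [DecidableEq B]

/-- The initial operator `ρ ⊗ |Φ⟩⟨Φ| ⊗ |s₀⟩⟨s₀| ⊗ |t₀⟩⟨t₀|` of the joint laboratory, with `Φ` the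
shared maximally entangled state. -/
def initial (P : AssistedProtocol A B) (ρ : Matrix (A × B) (A × B) ℂ) :
    Matrix ((A × Fin P.N × P.S) × (B × Fin P.N × P.T))
      ((A × Fin P.N × P.S) × (B × Fin P.N × P.T)) ℂ :=
  Matrix.of fun p q =>
    ρ (p.1.1, p.2.1) (q.1.1, q.2.1)
      * (maxEntangled P.N (p.1.2.1, p.2.2.1) * star (maxEntangled P.N (q.1.2.1, q.2.2.1)))
      * (if p.1.2.2 = P.s₀ ∧ q.1.2.2 = P.s₀ ∧ p.2.2.2 = P.t₀ ∧ q.2.2.2 = P.t₀ then 1 else 0)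

/-- The partial trace over everything but the systems `A` and `B`. -/
def reduce (P : AssistedProtocol A B)
    (σ : Matrix ((A × Fin P.N × P.S) × (B × Fin P.N × P.T))
      ((A × Fin P.N × P.S) × (B × Fin P.N × P.T)) ℂ) : Matrix (A × B) (A × B) ℂ :=
  Matrix.of fun p q =>
    ∑ u : Fin P.N × P.S, ∑ v : Fin P.N × P.T, σ ((p.1, u), (p.2, v)) ((q.1, u), (q.2, v))

/-- The quantum channel on `A × B` that the protocol realises. -/
def channel (P : AssistedProtocol A B) (ρ : Matrix (A × B) (A × B) ℂ) :
    Matrix (A × B) (A × B) ℂ :=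
  P.reduce (P.locc.run (P.initial ρ))

/-- The protocol implements `U` exactly and deterministically: the channel it realises is
`ρ ↦ U ρ U†`. -/
def Implements (P : AssistedProtocol A B) (U : Matrix (A × B) (A × B) ℂ) : Prop :=
  ∀ ρ : Matrix (A × B) (A × B) ℂ, P.channel ρ = U * ρ * Uᴴ

/-- The initial entanglement: a maximally entangled state of Schmidt rank `N` has `log₂ N`
ebits. -/
def ebits (P : AssistedProtocol A B) : ℝ := Real.logb 2 P.N

/-- The number of bits of classical communication. -/
def cbits (P : AssistedProtocol A B) : ℝ := P.locc.cbits

end AssistedProtocol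

/-- `U` can be implemented by local operations with the help of `e` ebits of entanglement and `c`
bits of classical communication. -/
def ImplementableUsing {A B : Type} [Fintype A] [DecidableEq A] [Fintype B] [DecidableEq B]
    (U : Matrix (A × B) (A × B) ℂ) (e c : ℝ) : Prop :=
  ∃ P : AssistedProtocol A B, P.Implements U ∧ P.ebits = e ∧ P.cbits = c

end BipartiteLOCC

end

/-!
Let `U` be the permutation unitary of `π`, and call the support of the block `⟨a'|U|a⟩`, with
`a' = (π (a, b)).1`, the label of the input `(a, b)` (`blockLabel`). The label makes the two halves
of `U` local: given the label, Alice can transform `a` into `a'` and Bob can transform `b` into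
`b' = (π (a, b)).2`, both reversibly (`isTransitionLabel_blockLabel`). So the task is to compute the
label from the input, coherently, and to remove it after use.

Registers are moved by two primitives. To copy (`Achieves.copy_left`), the sender measures his half
of a maximally entangled state, shifted by the content of the register, and sends the outcome. To
erase (`Achieves.erase_left`), the sender measures in the Fourier basis a register whose content is
a function of what the receiver holds, who corrects the phase. To copy a register of size `K`
and later erase it or its original costs `log₂ K` ebits and `2 log₂ K` bits. Everything else is a
local relabelling of basis states, which is possible exactly if the old and new states of the
laboratory determine each other. Hence all states are given by functions into the basis, and
the verification of the protocols reduces to comparing kernels of functions.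

The sizes of the registers are bounded by the Schmidt rank `r`. The blocks of `U` lie in a space of
dimension `r`, so `r` positions determine a block (`exists_finset_blockLabel`): there are at most
`2 ^ r - 1` labels. The blocks that belong to one `a` have disjoint supports, so they form a family
of disjoint nonempty subsets of the `r` positions: there are at most `r` of them, and at most
`Nat.bell (r + 1)` families (`card_disjointFamilies_le`). The column sums of the blocks
span a space of dimension at most `r` that contains the constant function `1`; so there are at most
`2 ^ (r - 1)` classes of inputs `b` that act differently on the first system
(`exists_inputClass`), and by transposition just as many classes of outputs `b'`
(`exists_outputClass`).

For the cost `8 * r - 8`, Bob passes the class of `b` to Alice, who finds the label and passes it on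
to Bob. For the cost with the Bell number, Alice passes to Bob the family that belongs to `a`, and
Bob passes to Alice the number of the label in this family. In both cases the class of `b'`,
passed to Alice, enables her to clear the label, since `a'` and this class determine it.
-/

namespace BipartiteLOCC

/-! ### Linearity of protocols and exchange of the parties -/

namespace LOCC

variable {α β : Type} [Fintype α] [DecidableEq α] [Fintype β] [DecidableEq β]

theorem run_smul (P : LOCC α β) (c : ℂ) (σ : Matrix (α × β) (α × β) ℂ) :
    P.run (c • σ) = c • P.run σ := by
  induction P generalizing σ with
  | done => rfl
  | alice K hK next ih =>
    simp only [run, Finset.smul_sum, ← ih, Matrix.mul_smul, Matrix.smul_mul]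
  | bob K hK next ih =>
    simp only [run, Finset.smul_sum, ← ih, Matrix.mul_smul, Matrix.smul_mul]

/-- The protocol with the roles of Alice and Bob exchanged. -/
def swap : LOCC α β → LOCC β α
  | done => done
  | alice K hK next => bob K hK fun x => (next x).swap
  | bob K hK next => alice K hK fun x => (next x).swap

theorem cbits_swap (P : LOCC α β) : P.swap.cbits = P.cbits := by
  induction P with
  | done => rfl
  | alice K hK next ih => simp only [swap, cbits, ih]
  | bob K hK next ih => simp only [swap, cbits, ih]

theorem run_swap (P : LOCC α β) (σ : Matrix (α × β) (α × β) ℂ) :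
    P.swap.run (σ.submatrix Prod.swap Prod.swap) =
      (P.run σ).submatrix Prod.swap Prod.swap := by
  have hl (K : Matrix α α ℂ) : (1 : Matrix β β ℂ) ⊗ₖ K =
      (K ⊗ₖ (1 : Matrix β β ℂ)).submatrix Prod.swap Prod.swap := by
    ext ⟨x, y⟩ ⟨x', y'⟩
    exact mul_comm _ _
  have hr (K : Matrix β β ℂ) : K ⊗ₖ (1 : Matrix α α ℂ) =
      ((1 : Matrix α α ℂ) ⊗ₖ K).submatrix Prod.swap Prod.swap := by
    ext ⟨x, y⟩ ⟨x', y'⟩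
    exact mul_comm _ _
  have hm (X Y : Matrix (α × β) (α × β) ℂ) :
      X.submatrix (Prod.swap : β × α → α × β) Prod.swap * Y.submatrix Prod.swap Prod.swap =
        (X * Y).submatrix Prod.swap Prod.swap :=
    Matrix.submatrix_mul_equiv X Y _ (Equiv.prodComm β α) _
  have hs {ι : Type} (s : Finset ι) (X : ι → Matrix (α × β) (α × β) ℂ) :
      (∑ i ∈ s, X i).submatrix (Prod.swap : β × α → α × β) Prod.swap =
        ∑ i ∈ s, (X i).submatrix Prod.swap Prod.swap := by
    ext x y; simp [Matrix.sum_apply]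
  induction P generalizing σ with
  | done => rfl
  | alice K hK next ih =>
    simp only [run, swap, hl, hm, Matrix.conjTranspose_submatrix, hs, ← ih]
  | bob K hK next ih =>
    simp only [run, swap, hr, hm, Matrix.conjTranspose_submatrix, hs, ← ih]

end LOCC

/-! ### Weighted functions and superpositions of basis states -/

/-- The operator `∑ y, w y |h y⟩⟨y|`. -/
def weightedMap {α : Type} [DecidableEq α] (h : α → α) (w : α → ℂ) : Matrix α α ℂ :=
  Matrix.of fun u y => if h y = u then w y else 0

/-- The operator `∑ i, ∑ ω, w i ω |p i ω⟩|q i ω⟩⟨i|`. -/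
def weightedSum {I Ω α β : Type} [Fintype Ω] [DecidableEq α] [DecidableEq β]
    (p : I → Ω → α) (q : I → Ω → β) (w : I → Ω → ℂ) : Matrix (α × β) I ℂ :=
  Matrix.of fun u i => ∑ ω, if p i ω = u.1 ∧ q i ω = u.2 then w i ω else 0

section

variable {I Ω α β : Type} [Fintype Ω] [Fintype α] [DecidableEq α] [Fintype β] [DecidableEq β]

theorem kronecker_mul_weightedSum (p : I → Ω → α) (q : I → Ω → β) (w : I → Ω → ℂ)
    (h : α → α) (c : α → ℂ) (k : β → β) (d : β → ℂ) :
    (weightedMap h c ⊗ₖ weightedMap k d) * weightedSum p q w =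
      weightedSum (fun i ω => h (p i ω)) (fun i ω => k (q i ω))
        (fun i ω => c (p i ω) * d (q i ω) * w i ω) := by
  ext ⟨u, v⟩ i
  simp only [Matrix.mul_apply, weightedSum, weightedMap, Matrix.kroneckerMap_apply, Matrix.of_apply,
    Finset.mul_sum]
  rw [Finset.sum_comm]
  refine Finset.sum_congr rfl fun ω _ => ?_
  rw [Finset.sum_eq_single (p i ω, q i ω)]
  · by_cases h1 : h (p i ω) = u <;> by_cases h2 : k (q i ω) = v <;> simp [h1, h2]
  · rintro ⟨x, y⟩ - hne
    have : ¬(p i ω = x ∧ q i ω = y) := by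
      rintro ⟨rfl, rfl⟩
      exact hne rfl
    simp [this]
  · simp

/-- Measuring the component `ζ` of an injective pair `(h, ζ)` in an orthonormal basis, whose
coefficients are `c`, is a trace preserving instrument, even though the other component `h` alone
need not be injective. -/
theorem sum_conjTranspose_mul_weightedMap {M : Type} [Fintype M] [DecidableEq M] (h : α → α)
    (ζ : α → M) (hinj : Function.Injective fun y => (h y, ζ y)) (c : M → M → ℂ)
    (hc : ∀ z z', ∑ m, star (c m z) * c m z' = if z = z' then 1 else 0) :
    ∑ m, ∑ _s : Unit, (weightedMap h fun y => c m (ζ y))ᴴ * weightedMap h (fun y => c m (ζ y)) =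
      1 := by
  ext y y'
  simp only [Finset.univ_unique, Finset.sum_singleton, Matrix.sum_apply, Matrix.mul_apply,
    Matrix.conjTranspose_apply, weightedMap, Matrix.of_apply]
  have key (m : M) : ∑ u, star (if h y = u then c m (ζ y) else 0) *
      (if h y' = u then c m (ζ y') else 0) =
        if h y = h y' then star (c m (ζ y)) * c m (ζ y') else 0 := by
    rw [Finset.sum_eq_single (h y)]
    · by_cases e : h y = h y'
      · simp [e]
      · simp [e, Ne.symm e]
    · intro u _ hu
      simp [hu.symm]
    · simp
  simp only [key]
  by_cases e : h y = h y'
  · simp only [e, if_true, hc, Matrix.one_apply]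
    have : ζ y = ζ y' ↔ y = y' := ⟨fun e' => hinj (Prod.ext e e'), fun e' => e' ▸ rfl⟩
    simp [this]
  · have : y ≠ y' := fun e' => e (e' ▸ rfl)
    simp [e, this]

theorem conjTranspose_mul_weightedMap_equiv (k : β ≃ β) (d : β → ℂ)
    (hd : ∀ y, star (d y) * d y = 1) :
    ∑ _x : Unit, ∑ _s : Unit, (weightedMap k d)ᴴ * weightedMap k d = 1 := by
  ext y y'
  simp only [Finset.univ_unique, Finset.sum_singleton, Matrix.mul_apply,
    Matrix.conjTranspose_apply, weightedMap, Matrix.of_apply, Matrix.one_apply]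
  rw [Finset.sum_eq_single (k y)]
  · by_cases e : y = y'
    · subst e; simpa using hd y
    · simp [e, Ne.symm e]
  · intro u _ hu
    simp [hu.symm]
  · simp

/-! ### One round of communication -/

/-- One message from Alice to Bob: Alice measures the component `ζ` of the injection `(h, ζ)` in
the basis with coefficients `c`, and Bob applies a monomial unitary depending on the outcome. -/
def aliceRound {M : Type} [Fintype M] [DecidableEq M] (h : α → α)
    (ζ : α → M) (hinj : Function.Injective fun y => (h y, ζ y)) (c : M → M → ℂ)
    (hc : ∀ z z', ∑ m, star (c m z) * c m z' = if z = z' then 1 else 0)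
    (k : M → β ≃ β) (d : M → β → ℂ) (hd : ∀ m y, star (d m y) * d m y = 1) (next : LOCC α β) :
    LOCC α β :=
  .alice (fun m (_ : Unit) => weightedMap h fun y => c m (ζ y))
    (sum_conjTranspose_mul_weightedMap h ζ hinj c hc) fun m =>
      .bob (fun (_ : Unit) (_ : Unit) => weightedMap (k m) (d m))
        (conjTranspose_mul_weightedMap_equiv (k m) (d m) (hd m)) fun _ => next

variable {M : Type} [Fintype M] [DecidableEq M] (h : α → α)
    (ζ : α → M) (hinj : Function.Injective fun y => (h y, ζ y)) (c : M → M → ℂ)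
    (hc : ∀ z z', ∑ m, star (c m z) * c m z' = if z = z' then 1 else 0)
    (k : M → β ≃ β) (d : M → β → ℂ) (hd : ∀ m y, star (d m y) * d m y = 1) (next : LOCC α β)

theorem cbits_aliceRound [Nonempty M] :
    (aliceRound h ζ hinj c hc k d hd next).cbits =
      Real.logb 2 (Fintype.card M) + next.cbits := by
  simp [aliceRound, LOCC.cbits]

theorem run_aliceRound [Fintype I] (p : I → Ω → α) (q : I → Ω → β) (ρ : Matrix I I ℂ) :
    (aliceRound h ζ hinj c hc k d hd next).run
        (weightedSum p q (fun _ _ => 1) * ρ * (weightedSum p q fun _ _ => 1)ᴴ) =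
      ∑ m, next.run
        (weightedSum (fun i ω => h (p i ω)) (fun i ω => k m (q i ω))
            (fun i ω => c m (ζ (p i ω)) * d m (q i ω)) * ρ *
          (weightedSum (fun i ω => h (p i ω)) (fun i ω => k m (q i ω))
            (fun i ω => c m (ζ (p i ω)) * d m (q i ω)))ᴴ) := by
  simp only [aliceRound, LOCC.run, Finset.univ_unique, Finset.sum_singleton]
  refine Finset.sum_congr rfl fun m _ => ?_
  congr 1
  have e := kronecker_mul_weightedSum p q (fun _ _ => 1) h (fun y => c m (ζ y)) (k m) (d m)
  simp only [mul_one] at e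
  have e' : weightedMap h (fun y => c m (ζ y)) ⊗ₖ weightedMap (k m) (d m) =
      ((1 : Matrix α α ℂ) ⊗ₖ weightedMap (k m) (d m)) *
        (weightedMap h (fun y => c m (ζ y)) ⊗ₖ (1 : Matrix β β ℂ)) := by
    rw [← Matrix.mul_kronecker_mul, one_mul, mul_one]
  rw [← e, e']
  simp only [Matrix.conjTranspose_mul, Matrix.mul_assoc]

end

/-! ### Copying and erasing registers -/

/-- A partially defined injection between finite types, given by two functions with the same
kernel, extends to an injection defined everywhere. -/
theorem exists_injective_extension {X α γ : Type} [Fintype α] [Fintype γ]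
    (hcard : Fintype.card α ≤ Fintype.card γ) (p : X → α) (g : X → γ)
    (hk : ∀ x y, p x = p y ↔ g x = g y) :
    ∃ h : α → γ, Function.Injective h ∧ ∀ x, h (p x) = g x := by
  classical
  rcases isEmpty_or_nonempty α with hα | ⟨⟨a₀⟩⟩
  · exact ⟨fun a => isEmptyElim a, fun a => isEmptyElim a, fun x => isEmptyElim (p x)⟩
  have : Nonempty γ := Fintype.card_pos_iff.1 ((Fintype.card_pos_iff.2 ⟨a₀⟩).trans_le hcard)
  let f : α → γ := Function.extend p g fun _ => Classical.arbitrary γ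
  have hf (x : X) : f (p x) = g x :=
    Function.FactorsThrough.extend_apply (fun x y e => (hk x y).1 e) _ x
  let s : Finset α := Finset.univ.filter (· ∈ Set.range p)
  have hs {a : α} : a ∈ s ↔ ∃ x, p x = a := by simp [s]
  have hinj : Set.InjOn f s := by
    intro a ha b hb e
    obtain ⟨x, rfl⟩ := hs.1 ha
    obtain ⟨y, rfl⟩ := hs.1 hb
    exact (hk x y).2 (by simpa [hf] using e)
  obtain ⟨t, hst, -, ht⟩ := Finset.exists_subsuperset_card_eq (s := s.image f)
    (t := Finset.univ) (n := Fintype.card α) (Finset.subset_univ _)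
    (Finset.card_image_le.trans (Finset.card_le_univ s)) hcard
  obtain ⟨e, he⟩ := Finset.exists_equiv_extend_of_card_eq ht.symm hst hinj
  exact ⟨fun a => (e a : γ), fun a b hab => e.injective (Subtype.ext hab),
    fun x => (he _ (hs.2 ⟨x, rfl⟩)).trans (hf x)⟩

theorem exists_equiv_extension {X α : Type} [Fintype α] (p g : X → α)
    (hk : ∀ x y, p x = p y ↔ g x = g y) : ∃ h : α ≃ α, ∀ x, h (p x) = g x := by
  obtain ⟨h, hinj, he⟩ := exists_injective_extension le_rfl p g hk
  exact ⟨Equiv.ofBijective h (Finite.injective_iff_bijective.1 hinj), he⟩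

/-- Some protocol with `C` bits of communication transforms, coherently in `i`, the
(unnormalised) states `∑ ω, |p i ω⟩|q i ω⟩` into the basis states `|pf i⟩|qf i⟩`. The factor
`card Ω` is the squared norm of the former when their terms are orthogonal. -/
def Achieves {I Ω α β : Type} [Fintype I] [Fintype Ω] [Fintype α] [DecidableEq α] [Fintype β]
    [DecidableEq β] (pf : I → α) (qf : I → β) (p : I → Ω → α) (q : I → Ω → β) (C : ℝ) : Prop :=
  ∃ P : LOCC α β, P.cbits = C ∧ ∀ ρ : Matrix I I ℂ,
    P.run (weightedSum p q (fun _ _ => 1) * ρ * (weightedSum p q fun _ _ => 1)ᴴ) =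
      (Fintype.card Ω : ℂ) •
        (weightedSum (fun i (_ : Unit) => pf i) (fun i _ => qf i) (fun _ _ => 1) * ρ *
          (weightedSum (fun i (_ : Unit) => pf i) (fun i _ => qf i) fun _ _ => 1)ᴴ)

section

variable {I Ω α β : Type} [Fintype I] [Fintype Ω] [Fintype α] [DecidableEq α] [Fintype β]
  [DecidableEq β] {pf : I → α} {qf : I → β} {C : ℝ} {K : ℕ} [NeZero K]

theorem achieves_final : Achieves pf qf (fun i (_ : Unit) => pf i) (fun i _ => qf i) 0 :=
  ⟨.done, rfl, fun ρ => by simp [LOCC.run]⟩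

theorem Achieves.swap {p : I → Ω → α} {q : I → Ω → β} (h : Achieves pf qf p q C) :
    Achieves qf pf q p C := by
  obtain ⟨P, hP, h⟩ := h
  refine ⟨P.swap, (LOCC.cbits_swap P).trans hP, fun ρ => ?_⟩
  have hw {Ω : Type} [Fintype Ω] (p : I → Ω → α) (q : I → Ω → β) :
      weightedSum q p (fun _ _ => 1) =
        (weightedSum p q (fun _ _ => 1)).submatrix Prod.swap id := by
    ext ⟨u, v⟩ i
    simp [weightedSum, and_comm]
  have hs {Ω : Type} [Fintype Ω] (p : I → Ω → α) (q : I → Ω → β) :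
      weightedSum q p (fun _ _ => 1) * ρ * (weightedSum q p fun _ _ => 1)ᴴ =
        (weightedSum p q (fun _ _ => 1) * ρ * (weightedSum p q fun _ _ => 1)ᴴ).submatrix
          Prod.swap Prod.swap := by
    rw [hw]; rfl
  rw [hs, LOCC.run_swap, h, hs]
  rfl

/-- Alice measures a register that, up to a shift by `t i` known to her, is maximally entangled
with a register of Bob, and sends the outcome. Undoing the shift leaves `t i` in the register of
Bob. -/
theorem Achieves.copy_left {p : I → ZMod K × Ω → α} {q : I → ZMod K × Ω → β}
    (p' : I → Ω → α) (q' : I → Ω → β) (t : I → ZMod K) (h : Achieves pf qf p' q' C)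
    (hp : ∀ i i' m m' ω ω', p i (m + t i, ω) = p i' (m' + t i', ω') ↔
      p' i ω = p' i' ω' ∧ m = m')
    (hq : ∀ i i' m ω ω', q i (m + t i, ω) = q i' (m + t i', ω') ↔ q' i ω = q' i' ω') :
    Achieves pf qf p q (Real.logb 2 K + C) := by
  obtain ⟨P, hP, h⟩ := h
  obtain ⟨g, hg, hgp⟩ := exists_injective_extension (X := I × ZMod K × Ω) (α := α)
    (γ := α × ZMod K) (by simpa using Nat.le_mul_of_pos_right _ (NeZero.pos K))
    (fun x => p x.1 (x.2.1 + t x.1, x.2.2)) (fun x => (p' x.1 x.2.2, x.2.1))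
    (fun x y => by simpa using hp x.1 y.1 x.2.1 y.2.1 x.2.2 y.2.2)
  choose k hk using fun m : ZMod K => exists_equiv_extension (X := I × Ω)
    (fun x => q x.1 (m + t x.1, x.2)) (fun x => q' x.1 x.2)
    (fun x y => hq x.1 y.1 m x.2 y.2)
  refine ⟨aliceRound (fun a => (g a).1) (fun a => (g a).2) hg (fun m z => if m = z then 1 else 0)
    (fun z z' => by simp [eq_comm]) k (fun _ _ => 1) (by simp) P, ?_, fun ρ => ?_⟩
  · rw [cbits_aliceRound, ZMod.card, hP]
  rw [run_aliceRound]
  have key (m : ZMod K) : weightedSum (fun i ω => (g (p i ω)).1) (fun i ω => k m (q i ω))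
      (fun i ω => (if m = (g (p i ω)).2 then (1 : ℂ) else 0) * 1) =
        weightedSum p' q' fun _ _ => 1 := by
    ext u i
    simp only [weightedSum, Matrix.of_apply, Fintype.sum_prod_type]
    rw [← Equiv.sum_comp (Equiv.addRight (t i)), Finset.sum_eq_single m]
    · refine Finset.sum_congr rfl fun ω _ => ?_
      have e1 := hgp (i, m, ω)
      have e2 := hk m (i, ω)
      simp only at e1 e2
      simp [e1, e2]
    · intro m' _ hm
      refine Finset.sum_eq_zero fun ω _ => ?_
      have e1 := hgp (i, m', ω)
      simp only at e1
      simp [e1, hm.symm]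
    · simp
  simp only [key, h, Finset.sum_const, Finset.card_univ, ZMod.card, Fintype.card_prod,
    Nat.cast_mul, mul_smul, Nat.cast_smul_eq_nsmul]

/-- Alice measures in the Fourier basis a register whose content `t i ω` is known to Bob, and
sends the outcome. The measurement disturbs nothing but the phases, which Bob corrects. -/
theorem Achieves.erase_left {p : I → Ω → α} {q : I → Ω → β}
    (p' : I → Ω → α) (q' : I → Ω → β) (t : I → Ω → ZMod K) (h : Achieves pf qf p' q' C)
    (hp : ∀ i i' ω ω', p i ω = p i' ω' ↔ p' i ω = p' i' ω' ∧ t i ω = t i' ω')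
    (hq : ∀ i i' ω ω', q i ω = q i' ω' ↔ q' i ω = q' i' ω')
    (ht : ∀ i i' ω ω', q i ω = q i' ω' → t i ω = t i' ω') :
    Achieves pf qf p q (Real.logb 2 K + C) := by
  obtain ⟨P, hP, h⟩ := h
  obtain ⟨g, hg, hgp⟩ := exists_injective_extension (X := I × Ω) (α := α)
    (γ := α × ZMod K) (by simpa using Nat.le_mul_of_pos_right _ (NeZero.pos K))
    (fun x => p x.1 x.2) (fun x => (p' x.1 x.2, t x.1 x.2))
    (fun x y => by simpa using hp x.1 y.1 x.2 y.2)
  obtain ⟨k, hk⟩ := exists_equiv_extension (X := I × Ω)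
    (fun x => q x.1 x.2) (fun x => q' x.1 x.2) (fun x y => hq x.1 y.1 x.2 y.2)
  let ζ : β → ZMod K := Function.extend (fun x : I × Ω => q x.1 x.2) (fun x => t x.1 x.2) 0
  have hζ (i : I) (ω : Ω) : ζ (q i ω) = t i ω :=
    Function.FactorsThrough.extend_apply (f := fun x : I × Ω => q x.1 x.2)
      (g := fun x => t x.1 x.2) (fun x y e => ht x.1 y.1 x.2 y.2 e) 0 (i, ω)
  have hK : (K : ℂ) ≠ 0 := Nat.cast_ne_zero.2 (NeZero.ne K)
  have hsq : ((Real.sqrt K : ℝ) : ℂ) * (Real.sqrt K : ℝ) = K := by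
    rw [← Complex.ofReal_mul, Real.mul_self_sqrt (Nat.cast_nonneg K), Complex.ofReal_natCast]
  have hchar (x : ZMod K) : star (ZMod.stdAddChar x : ℂ) = ZMod.stdAddChar (-x) := by
    rw [AddChar.map_neg_eq_conj]; rfl
  refine ⟨aliceRound (fun a => (g a).1) (fun a => (g a).2) hg
    (fun m z => ((Real.sqrt K : ℝ) : ℂ)⁻¹ * ZMod.stdAddChar (-(m * z))) (fun z z' => ?_)
    (fun _ => k) (fun m y => ZMod.stdAddChar (m * ζ y)) (fun m y => ?_) P, ?_, fun ρ => ?_⟩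
  · have e (m : ZMod K) : star (((Real.sqrt K : ℝ) : ℂ)⁻¹ * ZMod.stdAddChar (-(m * z))) *
        (((Real.sqrt K : ℝ) : ℂ)⁻¹ * ZMod.stdAddChar (-(m * z'))) =
          (K : ℂ)⁻¹ * ZMod.stdAddChar (m * (z - z')) := by
      rw [star_mul', hchar, mul_mul_mul_comm, ← AddChar.map_add_eq_mul, star_inv₀,
        ← hsq, mul_inv]
      congr 2
      · simp
      · ring
    simp only [e, ← Finset.mul_sum,
      AddChar.sum_mulShift _ (ZMod.isPrimitive_stdAddChar K), sub_eq_zero, ZMod.card]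
    split_ifs <;> simp [hK]
  · rw [hchar, ← AddChar.map_add_eq_mul]
    simp
  · rw [cbits_aliceRound, ZMod.card, hP]
  rw [run_aliceRound]
  have key (m : ZMod K) : weightedSum (fun i ω => (g (p i ω)).1) (fun i ω => k (q i ω))
      (fun i ω => ((Real.sqrt K : ℝ) : ℂ)⁻¹ * ZMod.stdAddChar (-(m * (g (p i ω)).2)) *
        ZMod.stdAddChar (m * ζ (q i ω))) =
        ((Real.sqrt K : ℝ) : ℂ)⁻¹ • weightedSum p' q' fun _ _ => 1 := by
    ext u i
    simp only [weightedSum, Matrix.of_apply, Matrix.smul_apply, smul_eq_mul, Finset.mul_sum]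
    refine Finset.sum_congr rfl fun ω _ => ?_
    have e1 := hgp (i, ω)
    have e2 := hk (i, ω)
    simp only at e1 e2
    rw [e1, e2, hζ, mul_assoc, ← AddChar.map_add_eq_mul]
    simp
  have hsq' : ((Real.sqrt K : ℝ) : ℂ)⁻¹ * star ((Real.sqrt K : ℝ) : ℂ)⁻¹ = (K : ℂ)⁻¹ := by
    rw [star_inv₀, ← hsq, mul_inv]
    simp
  simp only [key, Matrix.conjTranspose_smul, Matrix.smul_mul, Matrix.mul_smul, smul_smul,
    LOCC.run_smul, h, Finset.sum_const, Finset.card_univ, ZMod.card,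
    ← Nat.cast_smul_eq_nsmul ℂ]
  congr 1
  rw [mul_comm (star _), hsq', ← mul_assoc, mul_inv_cancel₀ hK, one_mul]

theorem Achieves.copy_right {p : I → ZMod K × Ω → α} {q : I → ZMod K × Ω → β}
    (p' : I → Ω → α) (q' : I → Ω → β) (t : I → ZMod K) (h : Achieves pf qf p' q' C)
    (hp : ∀ i i' m ω ω', p i (m + t i, ω) = p i' (m + t i', ω') ↔ p' i ω = p' i' ω')
    (hq : ∀ i i' m m' ω ω', q i (m + t i, ω) = q i' (m' + t i', ω') ↔
      q' i ω = q' i' ω' ∧ m = m') :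
    Achieves pf qf p q (Real.logb 2 K + C) :=
  (h.swap.copy_left q' p' t hq hp).swap

theorem Achieves.erase_right {p : I → Ω → α} {q : I → Ω → β}
    (p' : I → Ω → α) (q' : I → Ω → β) (t : I → Ω → ZMod K) (h : Achieves pf qf p' q' C)
    (hp : ∀ i i' ω ω', p i ω = p i' ω' ↔ p' i ω = p' i' ω')
    (hq : ∀ i i' ω ω', q i ω = q i' ω' ↔ q' i ω = q' i' ω' ∧ t i ω = t i' ω')
    (ht : ∀ i i' ω ω', p i ω = p i' ω' → t i ω = t i' ω') :
    Achieves pf qf p q (Real.logb 2 K + C) :=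
  (h.swap.erase_left q' p' t hq hp ht).swap

end

/-! ### From transformations of basis states to implementations -/

section

variable {A B : Type} [Fintype A] [DecidableEq A] [Fintype B] [DecidableEq B]

/-- A protocol that takes `|i⟩`, together with a maximally entangled state and ancillas, to
`|π i⟩`, together with a state of the other registers that does not depend on `i`, implements the
permutation unitary of `π`. -/
theorem implementableUsing_of_achieves (U : Matrix (A × B) (A × B) ℂ) (π : A × B → A × B)
    (hπ : ∀ i j, U i j = if π j = i then 1 else 0) {Ω S T : Type} [Fintype Ω]
    [Fintype S] [DecidableEq S] [Fintype T] [DecidableEq T] (s₀ : S) (t₀ : T) {N : ℕ} (hN : 0 < N)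
    (e : Ω ≃ Fin N) (u : Fin N × S) (v : Fin N × T) {C : ℝ}
    (h : Achieves (fun i : A × B => ((π i).1, u)) (fun i => ((π i).2, v))
      (fun i (ω : Ω) => (i.1, e ω, s₀)) (fun i ω => (i.2, e ω, t₀)) C) :
    ImplementableUsing U (Real.logb 2 N) C := by
  obtain ⟨P, hP, h⟩ := h
  refine ⟨⟨N, hN, S, T, s₀, t₀, P⟩, fun ρ => ?_, rfl, hP⟩
  have hN0 : (N : ℂ) ≠ 0 := Nat.cast_ne_zero.2 hN.ne'
  have hsq : ((Real.sqrt N : ℝ) : ℂ) * (Real.sqrt N : ℝ) = N := by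
    rw [← Complex.ofReal_mul, Real.mul_self_sqrt (Nat.cast_nonneg N), Complex.ofReal_natCast]
  have hV (x : A × Fin N × S) (y : B × Fin N × T) (i : A × B) :
      weightedSum (fun (i : A × B) (ω : Ω) => (i.1, e ω, s₀)) (fun i ω => (i.2, e ω, t₀))
        (fun _ _ => 1) (x, y) i =
      if i = (x.1, y.1) then (if x.2.1 = y.2.1 ∧ x.2.2 = s₀ ∧ y.2.2 = t₀ then 1 else 0 : ℂ)
        else 0 := by
    obtain ⟨a, k, s⟩ := x
    obtain ⟨b, l, t⟩ := y
    obtain ⟨a', b'⟩ := i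
    simp only [weightedSum, Matrix.of_apply]
    rw [← Equiv.sum_comp e.symm]
    simp only [Equiv.apply_symm_apply, Prod.mk.injEq]
    rw [Finset.sum_eq_single k]
    · simp only [← ite_and]
      refine if_congr ?_ rfl rfl
      tauto
    · intro k' _ hk
      simp [hk]
    · simp
  have hinit : AssistedProtocol.initial ⟨N, hN, S, T, s₀, t₀, P⟩ ρ =
      (N : ℂ)⁻¹ • (weightedSum (fun (i : A × B) (ω : Ω) => (i.1, e ω, s₀))
        (fun i ω => (i.2, e ω, t₀)) (fun _ _ => 1) * ρ *
        (weightedSum (fun (i : A × B) (ω : Ω) => (i.1, e ω, s₀))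
        (fun i ω => (i.2, e ω, t₀)) fun _ _ => 1)ᴴ) := by
    ext ⟨x, y⟩ ⟨x', y'⟩
    simp only [AssistedProtocol.initial, maxEntangled, Matrix.of_apply, Matrix.smul_apply,
      Matrix.mul_apply, Matrix.conjTranspose_apply, hV, ite_mul, zero_mul,
      Finset.sum_ite_eq', Finset.mem_univ, if_true, apply_ite star, star_zero,
      star_one, mul_ite, mul_zero, one_mul, mul_one, smul_eq_mul]
    have : ((Real.sqrt N : ℝ) : ℂ)⁻¹ * ((Real.sqrt N : ℝ) : ℂ)⁻¹ = (N : ℂ)⁻¹ := by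
      rw [← hsq, mul_inv]
    by_cases h1 : x.2.1 = y.2.1 <;> by_cases h2 : x'.2.1 = y'.2.1 <;>
      by_cases h3 : x.2.2 = s₀ <;> by_cases h4 : y.2.2 = t₀ <;>
      by_cases h5 : x'.2.2 = s₀ <;> by_cases h6 : y'.2.2 = t₀ <;>
      simp [h1, h2, h3, h4, h5, h6, this, mul_comm]
  have hcard : (Fintype.card Ω : ℂ) = N := by rw [Fintype.card_congr e, Fintype.card_fin]
  rw [AssistedProtocol.channel, hinit, LOCC.run_smul, h, hcard, smul_smul,
    inv_mul_cancel₀ hN0, one_smul]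
  have hW (x : A × Fin N × S) (y : B × Fin N × T) (i : A × B) :
      weightedSum (fun (i : A × B) (_ : Unit) => ((π i).1, u)) (fun i _ => ((π i).2, v))
        (fun _ _ => 1) (x, y) i =
      if x.2 = u ∧ y.2 = v then U (x.1, y.1) i else 0 := by
    obtain ⟨a, k⟩ := x
    obtain ⟨b, l⟩ := y
    simp only [weightedSum, Matrix.of_apply, hπ, Finset.univ_unique, Finset.sum_singleton,
      ← ite_and]
    refine if_congr ?_ rfl rfl
    simp only [Prod.ext_iff, eq_comm (a := u), eq_comm (a := v)]
    tauto
  ext ⟨a, b⟩ ⟨a', b'⟩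
  simp only [AssistedProtocol.reduce, Matrix.of_apply, Matrix.mul_apply,
    Matrix.conjTranspose_apply, hW]
  rw [Finset.sum_eq_single u, Finset.sum_eq_single v]
  · simp
  · intro y _ hy
    simp [hy]
  · simp
  · intro x _ hx
    simp [hx]
  · simp

end

/-! ### The two protocols -/

section

variable {A B : Type} [Fintype A] [DecidableEq A] [Fintype B] [DecidableEq B]
variable {K₁ K₂ K₃ : ℕ} [NeZero K₁] [NeZero K₂] [NeZero K₃]

/-- A maximally entangled state of Schmidt rank `K₁ * K₂ * K₃` consists of three registers. -/
noncomputable def threeRegisters (K₁ K₂ K₃ : ℕ) [NeZero K₁] [NeZero K₂] [NeZero K₃] :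
    ZMod K₁ × ZMod K₂ × ZMod K₃ × Unit ≃ Fin (K₁ * K₂ * K₃) :=
  Fintype.equivFinOfCardEq (by simp [ZMod.card, mul_assoc])

/-- `m (a, b)` is a label that allows Alice to transform her input `a` into her output
`(π (a, b)).1` and Bob to transform `b` into `(π (a, b)).2`, reversibly. -/
structure IsTransitionLabel {S : Type} (π : A × B → A × B) (m : A × B → S) : Prop where
  left : ∀ x y, m x = m y → (x.1 = y.1 ↔ (π x).1 = (π y).1)
  right : ∀ x y, m x = m y → (x.2 = y.2 ↔ (π x).2 = (π y).2)

variable {U : Matrix (A × B) (A × B) ℂ} {π : A × B → A × B} {S : Type} [Fintype S]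
  [DecidableEq S] {m : A × B → S}

theorem logb_cost :
    Real.logb 2 K₁ + (Real.logb 2 K₁ + (Real.logb 2 K₂ + (Real.logb 2 K₂ +
      (Real.logb 2 K₃ + (Real.logb 2 K₃ + 0))))) = 2 * Real.logb 2 (K₁ * K₂ * K₃ : ℕ) := by
  have h₁ : (K₁ : ℝ) ≠ 0 := Nat.cast_ne_zero.2 (NeZero.ne _)
  have h₂ : (K₂ : ℝ) ≠ 0 := Nat.cast_ne_zero.2 (NeZero.ne _)
  have h₃ : (K₃ : ℝ) ≠ 0 := Nat.cast_ne_zero.2 (NeZero.ne _)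
  push_cast
  rw [Real.logb_mul (mul_ne_zero h₁ h₂) h₃, Real.logb_mul h₁ h₂]
  ring

/-- The last stage of both protocols: the label `m`, held by Alice, is a function of her output and
of the class `t` of Bob's output. -/
theorem achieves_discard_label {T : Type} [Fintype T] [DecidableEq T] (s₀ : S) (t₀ : T)
    (t : A × B → ZMod K₃) (ht : ∀ x y, (π x).2 = (π y).2 → t x = t y)
    (hmt : ∀ x y, (π x).1 = (π y).1 → t x = t y → m x = m y) :
    Achieves
      (fun i : A × B => ((π i).1, threeRegisters K₁ K₂ K₃ (0, 0, 0, ()), s₀))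
      (fun i : A × B => ((π i).2, threeRegisters K₁ K₂ K₃ (0, 0, 0, ()), t₀))
      (fun i ω => ((π i).1, threeRegisters K₁ K₂ K₃ (0, 0, ω), m i))
      (fun i (ω : ZMod K₃ × Unit) => ((π i).2, threeRegisters K₁ K₂ K₃ (0, 0, ω), t₀))
      (Real.logb 2 K₃ + (Real.logb 2 K₃ + 0)) := by
  refine Achieves.copy_right
    (fun i _ => ((π i).1, threeRegisters K₁ K₂ K₃ (0, 0, t i, ()), m i))
    (fun i _ => ((π i).2, threeRegisters K₁ K₂ K₃ (0, 0, 0, ()), t₀)) t ?_ ?_ ?_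
  · refine Achieves.erase_left _ _ (fun i _ => t i) achieves_final ?_ ?_ ?_
    · rintro x y - -
      simp only [Prod.mk.injEq, EmbeddingLike.apply_eq_iff_eq]
      grind
    · rintro x y - -
      rfl
    · rintro x y - -
      simp only [Prod.mk.injEq]
      grind
  · rintro x y k - -
    simp only [Prod.mk.injEq, EmbeddingLike.apply_eq_iff_eq]
    grind
  · rintro x y k l - -
    simp only [Prod.mk.injEq, EmbeddingLike.apply_eq_iff_eq]
    grind

/-- The protocol of linear cost: Bob tells Alice the class `t₁` of his input, from which Alice
computes the label; she sends a code of the label to Bob; and Bob helps Alice to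
discard the label by telling her the class `t₃` of his output. -/
theorem implementableUsing_of_label_code (hπ : ∀ i j, U i j = if π j = i then 1 else 0)
    (hm : IsTransitionLabel π m) (s₀ : S)
    (t₁ : A × B → ZMod K₁) (ht₁ : ∀ x y, x.2 = y.2 → t₁ x = t₁ y)
    (hmt₁ : ∀ x y, x.1 = y.1 → t₁ x = t₁ y → m x = m y)
    (code : A × B → ZMod K₂) (hcode : ∀ x y, code x = code y ↔ m x = m y)
    (t₃ : A × B → ZMod K₃) (ht₃ : ∀ x y, (π x).2 = (π y).2 → t₃ x = t₃ y)
    (hmt₃ : ∀ x y, (π x).1 = (π y).1 → t₃ x = t₃ y → m x = m y) :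
    ImplementableUsing U (Real.logb 2 (K₁ * K₂ * K₃ : ℕ))
      (2 * Real.logb 2 (K₁ * K₂ * K₃ : ℕ)) := by
  have hl := hm.left
  have hr := hm.right
  rw [← logb_cost]
  refine implementableUsing_of_achieves U π hπ s₀ () (NeZero.pos _) (threeRegisters K₁ K₂ K₃)
    (threeRegisters K₁ K₂ K₃ (0, 0, 0, ()), s₀) (threeRegisters K₁ K₂ K₃ (0, 0, 0, ()), ()) ?_
  refine Achieves.copy_right
    (fun i ω => (i.1, threeRegisters K₁ K₂ K₃ (t₁ i, ω), s₀))
    (fun i ω => (i.2, threeRegisters K₁ K₂ K₃ (0, ω), ())) t₁ ?_ ?_ ?_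
  · refine Achieves.erase_left
      (fun i ω => ((π i).1, threeRegisters K₁ K₂ K₃ (0, ω), m i))
      (fun i ω => (i.2, threeRegisters K₁ K₂ K₃ (0, ω), ())) (fun i _ => t₁ i) ?_ ?_ ?_ ?_
    · refine Achieves.copy_left
        (fun i ω => ((π i).1, threeRegisters K₁ K₂ K₃ (0, 0, ω), m i))
        (fun i ω => (i.2, threeRegisters K₁ K₂ K₃ (0, code i, ω), ())) code ?_ ?_ ?_
      · refine Achieves.erase_right
          (fun i ω => ((π i).1, threeRegisters K₁ K₂ K₃ (0, 0, ω), m i))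
          (fun i ω => ((π i).2, threeRegisters K₁ K₂ K₃ (0, 0, ω), ()))
          (fun i _ => code i) (achieves_discard_label s₀ () t₃ ht₃ hmt₃) ?_ ?_ ?_
        · rintro x y k l
          rfl
        · rintro x y k l
          simp only [Prod.mk.injEq, EmbeddingLike.apply_eq_iff_eq]
          grind
        · rintro x y k l
          simp only [Prod.mk.injEq, EmbeddingLike.apply_eq_iff_eq]
          grind
      · rintro x y k l k' l'
        simp only [Prod.mk.injEq, EmbeddingLike.apply_eq_iff_eq]
        grind
      · rintro x y k l l'
        simp only [Prod.mk.injEq, EmbeddingLike.apply_eq_iff_eq]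
        grind
    · rintro x y k l
      simp only [Prod.mk.injEq, EmbeddingLike.apply_eq_iff_eq]
      grind
    · rintro x y k l
      rfl
    · rintro x y k l
      simp only [Prod.mk.injEq, EmbeddingLike.apply_eq_iff_eq]
      grind
  · rintro x y k l l'
    simp only [Prod.mk.injEq, EmbeddingLike.apply_eq_iff_eq]
    grind
  · rintro x y k l k' l'
    simp only [Prod.mk.injEq, EmbeddingLike.apply_eq_iff_eq]
    grind

/-- The protocol whose cost involves Bell numbers: Alice tells Bob the class `τ` of her input,
which consists of the labels that can occur; Bob computes his output and the number `j` of the label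
within the class, which he passes to Alice; and Bob helps Alice to discard the label by
telling her the class `t₃` of his output. -/
theorem implementableUsing_of_label_class (hπ : ∀ i j, U i j = if π j = i then 1 else 0)
    (hm : IsTransitionLabel π m) (s₀ : S)
    (τ : A × B → ZMod K₁) (hτ : ∀ x y, x.1 = y.1 → τ x = τ y)
    (hmτ : ∀ x y, x.2 = y.2 → τ x = τ y → m x = m y)
    (j : A × B → ZMod K₂) (hj : ∀ x y, τ x = τ y → (j x = j y ↔ m x = m y))
    (t₃ : A × B → ZMod K₃) (ht₃ : ∀ x y, (π x).2 = (π y).2 → t₃ x = t₃ y)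
    (hmt₃ : ∀ x y, (π x).1 = (π y).1 → t₃ x = t₃ y → m x = m y) :
    ImplementableUsing U (Real.logb 2 (K₁ * K₂ * K₃ : ℕ))
      (2 * Real.logb 2 (K₁ * K₂ * K₃ : ℕ)) := by
  have hl := hm.left
  have hr := hm.right
  rw [← logb_cost]
  refine implementableUsing_of_achieves U π hπ s₀ (0 : ZMod K₂) (NeZero.pos _)
    (threeRegisters K₁ K₂ K₃) (threeRegisters K₁ K₂ K₃ (0, 0, 0, ()), s₀)
    (threeRegisters K₁ K₂ K₃ (0, 0, 0, ()), 0) ?_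
  refine Achieves.copy_left
    (fun i ω => (i.1, threeRegisters K₁ K₂ K₃ (0, ω), s₀))
    (fun i ω => (i.2, threeRegisters K₁ K₂ K₃ (τ i, ω), 0)) τ ?_ ?_ ?_
  · refine Achieves.erase_right
      (fun i ω => (i.1, threeRegisters K₁ K₂ K₃ (0, ω), s₀))
      (fun i ω => ((π i).2, threeRegisters K₁ K₂ K₃ (0, ω), j i)) (fun i _ => τ i) ?_ ?_ ?_ ?_
    · refine Achieves.copy_right
        (fun i ω => (i.1, threeRegisters K₁ K₂ K₃ (0, j i, ω), s₀))
        (fun i ω => ((π i).2, threeRegisters K₁ K₂ K₃ (0, 0, ω), j i)) j ?_ ?_ ?_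
      · refine Achieves.erase_right
          (fun i ω => ((π i).1, threeRegisters K₁ K₂ K₃ (0, 0, ω), m i))
          (fun i ω => ((π i).2, threeRegisters K₁ K₂ K₃ (0, 0, ω), 0))
          (fun i _ => j i) (achieves_discard_label s₀ 0 t₃ ht₃ hmt₃) ?_ ?_ ?_
        · rintro x y k l
          simp only [Prod.mk.injEq, EmbeddingLike.apply_eq_iff_eq]
          grind
        · rintro x y k l
          simp only [Prod.mk.injEq, EmbeddingLike.apply_eq_iff_eq]
          grind
        · rintro x y k l
          simp only [Prod.mk.injEq, EmbeddingLike.apply_eq_iff_eq]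
          grind
      · rintro x y k l l'
        simp only [Prod.mk.injEq, EmbeddingLike.apply_eq_iff_eq]
        grind
      · rintro x y k l k' l'
        simp only [Prod.mk.injEq, EmbeddingLike.apply_eq_iff_eq]
        grind
    · rintro x y k l
      rfl
    · rintro x y k l
      simp only [Prod.mk.injEq, EmbeddingLike.apply_eq_iff_eq]
      grind
    · rintro x y k l
      simp only [Prod.mk.injEq, EmbeddingLike.apply_eq_iff_eq]
      grind
  · rintro x y k l k' l'
    simp only [Prod.mk.injEq, EmbeddingLike.apply_eq_iff_eq]
    grind
  · rintro x y k l l'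
    simp only [Prod.mk.injEq, EmbeddingLike.apply_eq_iff_eq]
    grind

end

/-! ### Counting families of disjoint sets -/

section

variable {X : Type} [DecidableEq X]

open Classical in
/-- The partitions of `s` into nonempty sets, as families of sets. -/
noncomputable def partitions (s : Finset X) : Finset (Finset (Finset X)) :=
  s.powerset.powerset.filter fun F =>
    ∅ ∉ F ∧ (F : Set (Finset X)).PairwiseDisjoint id ∧ F.biUnion id = s

open Classical in
/-- The families of pairwise disjoint nonempty subsets of `s`. -/
noncomputable def disjointFamilies (s : Finset X) : Finset (Finset (Finset X)) :=
  s.powerset.powerset.filter fun F => ∅ ∉ F ∧ (F : Set (Finset X)).PairwiseDisjoint id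

theorem mem_partitions {s : Finset X} {F : Finset (Finset X)} :
    F ∈ partitions s ↔
      ∅ ∉ F ∧ (F : Set (Finset X)).PairwiseDisjoint id ∧ F.biUnion id = s := by
  simp only [partitions, Finset.mem_filter, Finset.mem_powerset, and_iff_right_iff_imp]
  rintro ⟨-, -, rfl⟩ t ht
  exact Finset.mem_powerset.2 (Finset.subset_biUnion_of_mem id ht)

theorem mem_disjointFamilies {s : Finset X} {F : Finset (Finset X)} :
    F ∈ disjointFamilies s ↔
      (∀ t ∈ F, t ⊆ s) ∧ ∅ ∉ F ∧ (F : Set (Finset X)).PairwiseDisjoint id := by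
  simp only [disjointFamilies, Finset.mem_filter, Finset.mem_powerset, Finset.subset_iff]

theorem sum_powerset_bell {X : Type} (s : Finset X) :
    ∑ t ∈ s.powerset, Nat.bell (s.card - t.card) = Nat.bell (s.card + 1) := by
  rw [Finset.sum_powerset_apply_card fun k => Nat.bell (s.card - k), Nat.bell_succ,
    Nat.range_succ_eq_Iic]
  simp

theorem card_partitions_le (n : ℕ) (s : Finset X) (hs : s.card = n) :
    (partitions s).card ≤ Nat.bell n := by
  induction n using Nat.strong_induction_on generalizing s with
  | _ n ih =>
    rcases s.eq_empty_or_nonempty with rfl | ⟨x, hx⟩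
    · obtain rfl : n = 0 := by simpa using hs.symm
      refine (Finset.card_le_card (t := {∅}) fun F hF => ?_).trans (by simp)
      rw [mem_partitions] at hF
      rw [Finset.mem_singleton, Finset.eq_empty_iff_forall_notMem]
      intro t ht
      have : t ⊆ ∅ := hF.2.2 ▸ Finset.subset_biUnion_of_mem id ht
      exact hF.1 (Finset.subset_empty.1 this ▸ ht)
    · -- A partition of `s` consists of the part `insert x t` of `x` and a partition of the rest.
      have hsub : partitions s ⊆ (s.erase x).powerset.biUnion fun t =>
          (partitions (s.erase x \ t)).image (insert (insert x t)) := by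
        intro F hF
        rw [mem_partitions] at hF
        obtain ⟨h0, hd, hu⟩ := hF
        obtain ⟨P, hP, hxP⟩ : ∃ P ∈ F, x ∈ P := by simpa [← hu] using hx
        have hPs : P ⊆ s := hu ▸ Finset.subset_biUnion_of_mem id hP
        have hdis {Q : Finset X} (hQ : Q ∈ F) (hne : Q ≠ P) : Disjoint Q P := hd hQ hP hne
        refine Finset.mem_biUnion.2 ⟨P.erase x, Finset.mem_powerset.2
          (Finset.erase_subset_erase x hPs), Finset.mem_image.2 ⟨F.erase P, ?_, ?_⟩⟩
        · rw [mem_partitions]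
          refine ⟨fun h => h0 (Finset.mem_of_mem_erase h),
            hd.subset (by simp), ?_⟩
          ext y
          simp only [Finset.mem_biUnion, Finset.mem_erase, id, Finset.mem_sdiff, not_and, ← hu]
          constructor
          · rintro ⟨Q, ⟨hne, hQ⟩, hy⟩
            have hyP : y ∉ P := Finset.disjoint_left.1 (hdis hQ hne) hy
            exact ⟨⟨fun e => hyP (e ▸ hxP), Q, hQ, hy⟩, fun _ => hyP⟩
          · rintro ⟨⟨hyx, Q, hQ, hy⟩, hyP⟩
            exact ⟨Q, ⟨fun e => hyP hyx (e ▸ hy), hQ⟩, hy⟩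
        · rw [Finset.insert_erase hxP, Finset.insert_erase hP]
      have hcard : (s.erase x).card + 1 = n := by rw [Finset.card_erase_add_one hx, hs]
      calc (partitions s).card
          ≤ ∑ t ∈ (s.erase x).powerset,
              ((partitions (s.erase x \ t)).image (insert (insert x t))).card :=
            (Finset.card_le_card hsub).trans Finset.card_biUnion_le
        _ ≤ ∑ t ∈ (s.erase x).powerset, Nat.bell ((s.erase x).card - t.card) := by
            refine Finset.sum_le_sum fun t ht => Finset.card_image_le.trans ?_
            refine ih _ (by omega) _ ?_
            rw [Finset.card_sdiff_of_subset (Finset.mem_powerset.1 ht)]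
        _ = Nat.bell n := by rw [sum_powerset_bell, hcard]

/-- A family of disjoint nonempty subsets of `s` amounts to a partition of `s` with one more
point: the points outside the family form a part together with the additional point. -/
theorem card_disjointFamilies_le (s : Finset X) :
    (disjointFamilies s).card ≤ Nat.bell (s.card + 1) := by
  have hsub : disjointFamilies s ⊆ s.powerset.biUnion fun t => partitions (s \ t) := by
    intro F hF
    rw [mem_disjointFamilies] at hF
    refine Finset.mem_biUnion.2 ⟨s \ F.biUnion id, by simp, mem_partitions.2 ⟨hF.2.1, hF.2.2, ?_⟩⟩
    rw [Finset.sdiff_sdiff_eq_self]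
    exact Finset.biUnion_subset.2 hF.1
  rw [← sum_powerset_bell]
  refine (Finset.card_le_card hsub).trans (Finset.card_biUnion_le.trans ?_)
  refine Finset.sum_le_sum fun t ht => card_partitions_le _ _ ?_
  rw [Finset.card_sdiff_of_subset (Finset.mem_powerset.1 ht)]

theorem card_le_of_mem_disjointFamilies {s : Finset X} {F : Finset (Finset X)}
    (hF : F ∈ disjointFamilies s) : F.card ≤ s.card := by
  rw [mem_disjointFamilies] at hF
  refine (Finset.card_le_card_biUnion hF.2.2 fun t ht => ?_).trans
    (Finset.card_le_card (Finset.biUnion_subset.2 hF.1))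
  exact Finset.nonempty_iff_ne_empty.2 fun e => hF.2.1 (e ▸ ht)

theorem bell_mono : Monotone Nat.bell := by
  refine monotone_nat_of_le_succ fun n => ?_
  rw [Nat.bell_succ]
  refine le_trans ?_ (Finset.single_le_sum (fun _ _ => Nat.zero_le _)
    (Finset.mem_Iic.2 (Nat.zero_le n)))
  simp

theorem bell_pos (n : ℕ) : 0 < Nat.bell n :=
  lt_of_lt_of_le (by simp) (bell_mono (Nat.zero_le n))

theorem exists_injOn_zmod {K : ℕ} [NeZero K] (s : Finset X) (h : s.card ≤ K) :
    ∃ t : X → ZMod K, Set.InjOn t s := by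
  have : Fintype.card s ≤ Fintype.card (ZMod K) := by simpa [ZMod.card] using h
  obtain ⟨e⟩ := Function.Embedding.nonempty_of_card_le this
  refine ⟨fun x => if hx : x ∈ s then e ⟨x, hx⟩ else 0, fun x hx y hy hxy => ?_⟩
  have hx' : x ∈ s := hx
  have hy' : y ∈ s := hy
  simpa [hx', hy'] using hxy

end

/-! ### Few coordinates determine a low-dimensional family -/

/-- Linearly independent vectors `s`, in the span of `r` vectors, can be completed by at most
`r - s.ncard` members of a family in that span to vectors that generate the family. -/
theorem exists_finset_span {ι Q W : Type} [Fintype ι] [Nonempty Q] [AddCommGroup W] [Module ℂ W]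
    (x : ι → W) (s : Set W) (hs : LinearIndepOn ℂ id s)
    (hsx : s ⊆ Submodule.span ℂ (Set.range x)) (v : Q → W)
    (hv : ∀ q, v q ∈ Submodule.span ℂ (Set.range x)) :
    ∃ C : Finset Q, C.card + s.ncard ≤ Fintype.card ι ∧
      ∀ q, v q ∈ Submodule.span ℂ (s ∪ v '' C) := by
  classical
  obtain ⟨b, hbt, hsb, htb, hb⟩ := exists_linearIndepOn_id_extension hs
    (Set.subset_union_left (t := Set.range v))
  have hbx : b ⊆ Submodule.span ℂ (Set.range x) := by
    refine hbt.trans (Set.union_subset hsx ?_)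
    rintro _ ⟨q, rfl⟩
    exact hv q
  have : FiniteDimensional ℂ (Submodule.span ℂ (Set.range x)) :=
    FiniteDimensional.span_of_finite ℂ (Set.finite_range x)
  have hli : LinearIndependent ℂ
      (fun w : b => (⟨w, hbx w.2⟩ : Submodule.span ℂ (Set.range x))) :=
    LinearIndependent.of_comp (Submodule.subtype _) hb
  have hbfin : Finite b := hli.finite
  have hbcard : b.ncard ≤ Fintype.card ι := by
    have := Fintype.ofFinite b
    rw [← Nat.card_coe_set_eq, Nat.card_eq_fintype_card]
    exact hli.fintype_card_le_finrank.trans (finrank_range_le_card x)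
  have hpre (w : W) (hw : w ∈ b \ s) : ∃ q, v q = w := (hbt hw.1).resolve_left hw.2
  choose! g hg using hpre
  have hfin : (b \ s).Finite := (Set.toFinite b).subset Set.sdiff_subset
  refine ⟨hfin.toFinset.image g, ?_, fun q => ?_⟩
  · have h1 : (hfin.toFinset.image g).card ≤ (b \ s).ncard := by
      rw [Set.ncard_eq_toFinset_card _ hfin]
      exact Finset.card_image_le
    have h2 := Set.ncard_sdiff_add_ncard_of_subset hsb (Set.toFinite b)
    omega
  · refine Submodule.span_mono ?_ (htb (Or.inr ⟨q, rfl⟩))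
    intro w hw
    by_cases hws : w ∈ s
    · exact Or.inl hws
    · exact Or.inr ⟨g w, by simpa using ⟨w, ⟨hw, hws⟩, rfl⟩, hg w ⟨hw, hws⟩⟩

/-! ### The blocks of a bipartite permutation unitary -/

theorem IsPermutationUnitary.exists_perm {ι : Type} [Fintype ι] [DecidableEq ι]
    {U : Matrix ι ι ℂ} (hU : IsPermutationUnitary U) :
    ∃ π : Equiv.Perm ι, ∀ i j, U i j = if π j = i then 1 else 0 := by
  obtain ⟨hu, h01⟩ := hU
  have hu' (j j' : ι) : ∑ i, star (U i j) * U i j' = if j = j' then 1 else 0 := by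
    have := congrFun (congrFun (Matrix.mem_unitaryGroup_iff'.1 hu) j) j'
    simpa [Matrix.mul_apply, Matrix.one_apply, Matrix.star_apply] using this
  have hcol (j : ι) : ∃ k, ∀ i, U i j = if k = i then 1 else 0 := by
    have h1 : ((Finset.univ.filter fun i => U i j = 1).card : ℂ) = 1 := by
      have e (i : ι) : star (U i j) * U i j = if U i j = 1 then 1 else 0 := by
        rcases h01 i j with h | h <;> simp [h]
      have := hu' j j
      simp only [e, if_true] at this
      rwa [Finset.sum_boole] at this
    obtain ⟨k, hk⟩ := Finset.card_eq_one.1 (Nat.cast_eq_one.1 h1)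
    refine ⟨k, fun i => ?_⟩
    have : U i j = 1 ↔ i = k := by simpa using Finset.ext_iff.1 hk i
    rcases h01 i j with h | h <;> grind
  choose π hπ using hcol
  have hinj : Function.Injective π := by
    intro j j' e
    by_contra hne
    have := hu' j j'
    simp [hπ, hne, e] at this
  exact ⟨Equiv.ofBijective π (Finite.injective_iff_bijective.1 hinj),
    fun i j => hπ j i⟩

section

variable {A B : Type} [DecidableEq A] [Fintype B] [DecidableEq B]

/-- The support of the block `⟨(π x).1|U|x.1⟩`, an operator on the second system, where `U` is the
permutation unitary of `π`. Its elements are pairs of an output and an input of the second system. -/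
def blockLabel (π : A × B → A × B) (x : A × B) : Finset (B × B) :=
  Finset.univ.filter fun q => π (x.1, q.2) = ((π x).1, q.1)

theorem mem_blockLabel {π : A × B → A × B} {x : A × B} {q : B × B} :
    q ∈ blockLabel π x ↔ π (x.1, q.2) = ((π x).1, q.1) := by
  simp [blockLabel]

theorem self_mem_blockLabel (π : A × B → A × B) (x : A × B) :
    ((π x).2, x.2) ∈ blockLabel π x := by
  simp [mem_blockLabel]

theorem blockLabel_congr {π : A × B → A × B} {x y : A × B} (h : x.1 = y.1)
    (h' : (π x).1 = (π y).1) : blockLabel π x = blockLabel π y := by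
  simp [blockLabel, h, h']

theorem isTransitionLabel_blockLabel (π : Equiv.Perm (A × B)) :
    IsTransitionLabel π (blockLabel π) := by
  have key (x y : A × B) (h : blockLabel π x = blockLabel π y) :
      π (y.1, x.2) = ((π y).1, (π x).2) :=
    mem_blockLabel.1 (h ▸ self_mem_blockLabel π x)
  refine ⟨fun x y h => ⟨fun e => ?_, fun e => ?_⟩, fun x y h => ⟨fun e => ?_, fun e => ?_⟩⟩
  · have := key x y h
    rw [← e] at this
    exact (Prod.ext_iff.1 this).1
  · have := key x y h
    rw [← e] at this
    exact (congrArg Prod.fst (π.injective this)).symm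
  · have := key x y h
    rw [e] at this
    exact (congrArg Prod.snd this).symm
  · have := key x y h
    rw [e, Prod.mk.eta] at this
    exact (Prod.ext_iff.1 (π.injective this)).2

variable {U : Matrix (A × B) (A × B) ℂ} {r : ℕ} {X : Fin r → Matrix A A ℂ}
  {Y : Fin r → Matrix B B ℂ}

/-- At most `r` positions suffice to tell the blocks of `U` apart, from each other and from the
zero block. -/
theorem exists_finset_blockLabel [Nonempty B] (hUXY : U = ∑ j, X j ⊗ₖ Y j) (π : A × B → A × B)
    (hπ : ∀ i j, U i j = if π j = i then 1 else 0) :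
    ∃ C : Finset (B × B), C.card ≤ r ∧ (∀ x, (blockLabel π x ∩ C).Nonempty) ∧
      ∀ x y, blockLabel π x ∩ C = blockLabel π y ∩ C → blockLabel π x = blockLabel π y := by
  let v : B × B → A × A → ℂ := fun q p => U (p.1, q.1) (p.2, q.2)
  have hv (q : B × B) :
      v q ∈ Submodule.span ℂ (Set.range fun (j : Fin r) (p : A × A) => X j p.1 p.2) := by
    have : v q = ∑ j, Y j q.1 q.2 • fun p : A × A => X j p.1 p.2 := by
      ext p
      simp [v, hUXY, Matrix.sum_apply, Matrix.kroneckerMap_apply, mul_comm]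
    rw [this]
    exact Submodule.sum_mem _ fun j _ => Submodule.smul_mem _ _ (Submodule.subset_span ⟨j, rfl⟩)
  obtain ⟨C, hC, hspan⟩ := exists_finset_span _ ∅ (linearIndepOn_empty ℂ id)
    (Set.empty_subset _) v hv
  -- `v q p x` is the entry at the position `q` of the block with the label of `x`.
  have hmem (x : A × B) (q : B × B) :
      v q ((π x).1, x.1) = if q ∈ blockLabel π x then 1 else 0 := by
    simp [v, hπ, mem_blockLabel]
  have hext (φ : (A × A → ℂ) →ₗ[ℂ] ℂ) (h : ∀ q ∈ C, φ (v q) = 0) (q : B × B) : φ (v q) = 0 := by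
    have : Submodule.span ℂ (∅ ∪ v '' C) ≤ LinearMap.ker φ := by
      rw [Submodule.span_le]
      rintro _ (h' | ⟨q, hq, rfl⟩)
      · exact h'.elim
      · exact h q hq
    exact this (hspan q)
  refine ⟨C, by simpa using hC, fun x => ?_, fun x y hxy => ?_⟩
  · by_contra hne
    rw [Finset.not_nonempty_iff_eq_empty] at hne
    have := hext (LinearMap.proj ((π x).1, x.1)) (fun q hq => ?_) ((π x).2, x.2)
    · simp [hmem, self_mem_blockLabel] at this
    · have hq' : q ∉ blockLabel π x := fun h => by
        simpa [hne] using Finset.mem_inter.2 ⟨h, hq⟩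
      simp [hmem, hq']
  · ext q
    have := hext
      (.proj (φ := fun _ : A × A => ℂ) ((π x).1, x.1) - .proj ((π y).1, y.1))
      (fun q hq => ?_) q
    · simp only [LinearMap.sub_apply, LinearMap.proj_apply, hmem, sub_eq_zero] at this
      by_cases h1 : q ∈ blockLabel π x <;> by_cases h2 : q ∈ blockLabel π y <;> simp_all
    · have hiff : q ∈ blockLabel π x ↔ q ∈ blockLabel π y := by
        simpa [hq] using Finset.ext_iff.1 hxy q
      simp [hmem, hiff]

variable [Fintype A]

/-- The inputs of the second system fall into at most `2 ^ (r - 1)` classes, according to their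
effect on the first system. In the exponent, `1` is gained from a linear relation: every input
leads to some output. -/
theorem exists_inputClass [Nonempty A] [Nonempty B] (hUXY : U = ∑ j, X j ⊗ₖ Y j)
    (π : A × B → A × B) (hπ : ∀ i j, U i j = if π j = i then 1 else 0) {K : ℕ} [NeZero K]
    (hK : 2 ^ (r - 1) ≤ K) :
    ∃ t : B → ZMod K, ∀ b b', t b = t b' → ∀ a, (π (a, b)).1 = (π (a, b')).1 := by
  let v : A × A → B → ℂ := fun p b => ∑ b', U (p.1, b') (p.2, b)
  have hvπ (p : A × A) (b : B) : v p b = if (π (p.2, b)).1 = p.1 then 1 else 0 := by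
    simp only [v, hπ, Prod.ext_iff]
    by_cases h : (π (p.2, b)).1 = p.1 <;> simp [h]
  let y : Fin r → B → ℂ := fun j b => ∑ b', Y j b' b
  have hv (p : A × A) : v p ∈ Submodule.span ℂ (Set.range y) := by
    have : v p = ∑ j, X j p.1 p.2 • y j := by
      ext b
      simp only [v, y, hUXY, Matrix.sum_apply, Matrix.kroneckerMap_apply, Finset.sum_apply,
        Pi.smul_apply, smul_eq_mul, Finset.mul_sum]
      exact Finset.sum_comm
    rw [this]
    exact Submodule.sum_mem _ fun j _ => Submodule.smul_mem _ _ (Submodule.subset_span ⟨j, rfl⟩)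
  have hone : ({1} : Set (B → ℂ)) ⊆ Submodule.span ℂ (Set.range y) := by
    obtain ⟨a⟩ := ‹Nonempty A›
    have : (1 : B → ℂ) = ∑ a', v (a', a) := by
      ext b
      simp [hvπ]
    rw [Set.singleton_subset_iff, this]
    exact Submodule.sum_mem _ fun a' _ => hv _
  obtain ⟨C, hC, hspan⟩ := exists_finset_span y {1}
    (LinearIndepOn.singleton (v := id) (one_ne_zero : (1 : B → ℂ) ≠ 0)) hone v hv
  rw [Set.ncard_singleton, Fintype.card_fin] at hC
  obtain ⟨t, ht⟩ := exists_injOn_zmod (K := K) C.powerset (by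
    rw [Finset.card_powerset]
    exact (Nat.pow_le_pow_right (by norm_num) (by omega)).trans hK)
  refine ⟨fun b => t (C.filter fun p => (π (p.2, b)).1 = p.1), fun b b' hbb a => ?_⟩
  have hfil := ht (Finset.mem_powerset.2 (Finset.filter_subset _ _))
    (Finset.mem_powerset.2 (Finset.filter_subset _ _)) hbb
  have hle : Submodule.span ℂ ({1} ∪ v '' C) ≤
      LinearMap.ker (LinearMap.proj (R := ℂ) (φ := fun _ : B => ℂ) b - LinearMap.proj b') := by
    rw [Submodule.span_le]
    rintro _ (rfl | ⟨p, hp, rfl⟩)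
    · simp
    · have hp' : p ∈ C := hp
      have : (π (p.2, b)).1 = p.1 ↔ (π (p.2, b')).1 = p.1 := by
        simpa [hp'] using Finset.ext_iff.1 hfil p
      simp [hvπ, this]
  have := hle (hspan ((π (a, b)).1, a))
  simp only [LinearMap.mem_ker, LinearMap.sub_apply, LinearMap.proj_apply, hvπ, if_true,
    sub_eq_zero] at this
  by_contra hne
  simp [Ne.symm hne] at this

/-- The outputs of the second system fall into at most `2 ^ (r - 1)` classes, such that the class
and the output of the first system determine the input of the first system. -/
theorem exists_outputClass [Nonempty A] [Nonempty B] (hUXY : U = ∑ j, X j ⊗ₖ Y j)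
    (π : Equiv.Perm (A × B)) (hπ : ∀ i j, U i j = if π j = i then 1 else 0) {K : ℕ} [NeZero K]
    (hK : 2 ^ (r - 1) ≤ K) :
    ∃ t : B → ZMod K, ∀ x y, (π x).1 = (π y).1 → t (π x).2 = t (π y).2 → x.1 = y.1 := by
  have hT : Uᵀ = ∑ j, (X j)ᵀ ⊗ₖ (Y j)ᵀ := by
    rw [hUXY, Matrix.transpose_sum]
    rfl
  obtain ⟨t, ht⟩ := exists_inputClass (K := K) hT π.symm (fun i j => by
    rw [Matrix.transpose_apply, hπ]
    exact if_congr (by rw [Equiv.symm_apply_eq, eq_comm]) rfl rfl) hK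
  refine ⟨t, fun x y h h' => ?_⟩
  have := ht _ _ h' (π x).1
  nth_rw 2 [h] at this
  simpa using this

end

/-! ### The costs of the two protocols -/

section

variable {A B : Type} [Fintype A] [DecidableEq A] [Nonempty A]
  [Fintype B] [DecidableEq B] [Nonempty B] {U : Matrix (A × B) (A × B) ℂ} {r : ℕ}

theorem HasSchmidtRank.pos (hU : IsPermutationUnitary U) (hr : HasSchmidtRank U r) : 0 < r := by
  obtain ⟨π, hπ⟩ := hU.exists_perm
  obtain ⟨X, Y, -, -, hUXY⟩ := hr
  rcases Nat.eq_zero_or_pos r with rfl | h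
  · obtain ⟨x⟩ : Nonempty (A × B) := inferInstance
    have := hπ (π x) x
    simp [hUXY] at this
  · exact h

/-- The cost `8 * r - 8` is met with registers of sizes `2 ^ (r - 1)`, `2 ^ (6 * (r - 1))` and
`2 ^ (r - 1)`; the second has room for the labels, of which there are fewer than `2 ^ r`. -/
theorem implementableUsing_linear (hU : IsPermutationUnitary U) (hr : HasSchmidtRank U r) :
    ImplementableUsing U (8 * (r : ℝ) - 8) (2 * (8 * (r : ℝ) - 8)) := by
  have hr0 := hr.pos hU
  obtain ⟨π, hπ⟩ := hU.exists_perm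
  obtain ⟨X, Y, -, -, hUXY⟩ := hr
  obtain ⟨C, hC, hne, hCinj⟩ := exists_finset_blockLabel hUXY π hπ
  have : NeZero (2 ^ (r - 1)) := ⟨by positivity⟩
  have : NeZero (2 ^ (6 * (r - 1))) := ⟨by positivity⟩
  obtain ⟨t₁, ht₁⟩ := exists_inputClass hUXY π hπ le_rfl
  obtain ⟨t₃, ht₃⟩ := exists_outputClass hUXY π hπ le_rfl
  obtain ⟨code, hcode⟩ := exists_injOn_zmod (K := 2 ^ (6 * (r - 1))) (C.powerset.erase ∅) (by
    rw [Finset.card_erase_of_mem (Finset.empty_mem_powerset C), Finset.card_powerset]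
    -- The empty set is left out for the sake of `r = 1`, where no communication is allowed.
    obtain rfl | h2 : r = 1 ∨ 2 ≤ r := by omega
    · have : 2 ^ C.card ≤ 2 ^ 1 := Nat.pow_le_pow_right (by norm_num) hC
      simp only [Nat.sub_self, mul_zero, pow_zero]
      omega
    · exact (Nat.sub_le _ _).trans (Nat.pow_le_pow_right (by norm_num) (by omega)))
  have hmem (x : A × B) : blockLabel π x ∩ C ∈ ((C.powerset.erase ∅ : Finset _) : Set _) := by
    simpa [Finset.nonempty_iff_ne_empty] using hne x
  have key := implementableUsing_of_label_code hπ (isTransitionLabel_blockLabel π) ∅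
    (fun x => t₁ x.2) (fun x y h => congrArg t₁ h)
    (fun x y h h' => blockLabel_congr h (by
      have := ht₁ _ _ h' x.1
      nth_rw 2 [h] at this
      exact this))
    (fun x => code (blockLabel π x ∩ C))
    (fun x y => ⟨fun h => hCinj x y (hcode (hmem x) (hmem y) h), fun h => by rw [h]⟩)
    (fun x => t₃ (π x).2) (fun x y h => congrArg t₃ h)
    (fun x y h h' => blockLabel_congr (ht₃ x y h h') h)
  have hN : 2 ^ (r - 1) * 2 ^ (6 * (r - 1)) * 2 ^ (r - 1) = 2 ^ (8 * (r - 1)) := by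
    rw [← pow_add, ← pow_add]
    congr 1
    ring
  have hE : Real.logb 2 ((2 ^ (8 * (r - 1)) : ℕ) : ℝ) = 8 * (r : ℝ) - 8 := by
    rw [Nat.cast_pow, Nat.cast_ofNat, Real.logb_pow, Real.logb_self_eq_one (by norm_num)]
    push_cast [Nat.cast_sub (Nat.one_le_iff_ne_zero.2 hr0.ne')]
    ring
  rwa [hN, hE] at key

/-- The registers have the sizes `Nat.bell (r + 1)`, for the families of labels that belong to an
input of Alice, `r`, for the members of such a family, and `2 ^ r`, for the classes of the outputs
of Bob. -/
theorem implementableUsing_bell (hU : IsPermutationUnitary U) (hr : HasSchmidtRank U r) :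
    ImplementableUsing U (Real.logb 2 (Nat.bell (r + 1)) + r + Real.logb 2 r)
      (2 * (Real.logb 2 (Nat.bell (r + 1)) + r + Real.logb 2 r)) := by
  have hr0 := hr.pos hU
  obtain ⟨π, hπ⟩ := hU.exists_perm
  obtain ⟨X, Y, -, -, hUXY⟩ := hr
  obtain ⟨C, hC, hne, hCinj⟩ := exists_finset_blockLabel hUXY π hπ
  have : NeZero (Nat.bell (r + 1)) := ⟨(bell_pos _).ne'⟩
  have : NeZero r := ⟨hr0.ne'⟩
  have : NeZero (2 ^ r) := ⟨by positivity⟩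
  obtain ⟨t₃, ht₃⟩ := exists_outputClass (K := 2 ^ r) hUXY π hπ
    (Nat.pow_le_pow_right (by norm_num) (Nat.sub_le r 1))
  -- The blocks in the column `a`, restricted to the positions `C`.
  let F : A → Finset (Finset (B × B)) := fun a =>
    Finset.univ.image fun b => blockLabel π (a, b) ∩ C
  have hF (a : A) : F a ∈ disjointFamilies C := by
    simp only [mem_disjointFamilies, F, Finset.mem_image, Finset.mem_univ, true_and]
    refine ⟨?_, ?_, ?_⟩
    · rintro _ ⟨b, rfl⟩
      exact Finset.inter_subset_right
    · rintro ⟨b, hb⟩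
      exact (hne (a, b)).ne_empty hb
    · intro s hs s' hs' hss
      obtain ⟨b, rfl⟩ : ∃ b, blockLabel π (a, b) ∩ C = s := by simpa using hs
      obtain ⟨b', rfl⟩ : ∃ b, blockLabel π (a, b) ∩ C = s' := by simpa using hs'
      refine Finset.disjoint_left.2 fun q hq hq' => hss ?_
      have h1 := mem_blockLabel.1 (Finset.mem_inter.1 hq).1
      have h2 := mem_blockLabel.1 (Finset.mem_inter.1 hq').1
      rw [blockLabel_congr (x := (a, b)) (y := (a, b')) rfl
        (Prod.ext_iff.1 (h1.symm.trans h2)).1]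
  obtain ⟨τ, hτ⟩ := exists_injOn_zmod (K := Nat.bell (r + 1)) (disjointFamilies C)
    ((card_disjointFamilies_le C).trans (bell_mono (by omega)))
  have hτF {x y : A × B} (h : τ (F x.1) = τ (F y.1)) : F x.1 = F y.1 := hτ (hF _) (hF _) h
  choose j hj using fun a => exists_injOn_zmod (K := r) (F a)
    ((card_le_of_mem_disjointFamilies (hF a)).trans hC)
  -- The numbering of a family must not depend on the input `a` that has led to it.
  let a₀ : Finset (Finset (B × B)) → A := Function.invFun F
  have ha₀ (a : A) : F (a₀ (F a)) = F a := Function.invFun_eq ⟨a, rfl⟩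
  have hmem (x : A × B) : blockLabel π x ∩ C ∈ F x.1 :=
    Finset.mem_image.2 ⟨x.2, Finset.mem_univ _, rfl⟩
  have key := implementableUsing_of_label_class hπ (isTransitionLabel_blockLabel π) ∅
    (fun x => τ (F x.1)) (fun x y h => by simp only [h])
    (fun x y h h' => by
      have hx := hmem x
      rw [hτF h'] at hx
      obtain ⟨b, -, hb⟩ := Finset.mem_image.1 hx
      have hb' := hCinj _ _ hb
      have := mem_blockLabel.1 (hb' ▸ self_mem_blockLabel π x)
      rw [← hb']
      exact blockLabel_congr rfl (by rw [h] at this; exact (congrArg Prod.fst this).symm))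
    (fun x => j (a₀ (F x.1)) (blockLabel π x ∩ C))
    (fun x y h => ⟨fun e => hCinj x y (hj (a₀ (F x.1))
      (by rw [ha₀]; exact hmem x) (by rw [ha₀, hτF h]; exact hmem y)
      (by simpa only [hτF h] using e)), fun e => by simp only [hτF h, e]⟩)
    (fun x => t₃ (π x).2) (fun x y h => congrArg t₃ h)
    (fun x y h h' => blockLabel_congr (ht₃ x y h h') h)
  have hE : Real.logb 2 ((Nat.bell (r + 1) * r * 2 ^ r : ℕ) : ℝ) =
      Real.logb 2 (Nat.bell (r + 1)) + r + Real.logb 2 r := by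
    have h1 : (Nat.bell (r + 1) : ℝ) ≠ 0 := Nat.cast_ne_zero.2 (bell_pos _).ne'
    have h2 : (r : ℝ) ≠ 0 := Nat.cast_ne_zero.2 hr0.ne'
    push_cast
    rw [Real.logb_mul (mul_ne_zero h1 h2) (by positivity), Real.logb_mul h1 h2, Real.logb_pow,
      Real.logb_self_eq_one (by norm_num)]
    ring
  rwa [hE] at key

end

end BipartiteLOCC

theorem theorem2 {A B : Type} [Fintype A] [DecidableEq A] [Nonempty A]
    [Fintype B] [DecidableEq B] [Nonempty B]
    (U : Matrix (A × B) (A × B) ℂ) (hU : BipartiteLOCC.IsPermutationUnitary U)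
    (r : ℕ) (hr : BipartiteLOCC.HasSchmidtRank U r) :
    BipartiteLOCC.ImplementableUsing U
        (Real.logb 2 (Nat.bell (r + 1)) + r + Real.logb 2 r)
        (2 * (Real.logb 2 (Nat.bell (r + 1)) + r + Real.logb 2 r)) ∧
      BipartiteLOCC.ImplementableUsing U (8 * (r : ℝ) - 8) (2 * (8 * (r : ℝ) - 8)) ∧
      BipartiteLOCC.ImplementableUsing U
        (min (Real.logb 2 (Nat.bell (r + 1)) + r + Real.logb 2 r) (8 * (r : ℝ) - 8))
        (2 * min (Real.logb 2 (Nat.bell (r + 1)) + r + Real.logb 2 r) (8 * (r : ℝ) - 8)) := by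
  have h₁ := BipartiteLOCC.implementableUsing_bell hU hr
  have h₂ := BipartiteLOCC.implementableUsing_linear hU hr
  refine ⟨h₁, h₂, ?_⟩
  rcases min_choice (Real.logb 2 (Nat.bell (r + 1)) + r + Real.logb 2 r) (8 * (r : ℝ) - 8)
    with h | h
  · rwa [h]
  · rwa [h]
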